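/- All graphs are simple. For $n,k\in\mathbb N$ let $\square^n K_k$ be the graph whose vertices are the $n$-tuples with entries from a fixed $k$-element set, two tuples being adjacent if and only if they differ in exactly one coordinate. The dimension $\dim(G)$ of a graph $G$ is the least integer $n$ such that $G$ is isomorphic to an induced subgraph of $\square^n K_k$ for some $k\in\mathbb N$ (and $\dim(G)=\infty$ if there is no such $n$). A graph $G$ is $H$-induced-saturated if $G$ has no induced subgraph isomorphic to $H$, but deleting any edge of $G$, or adding to $G$ any edge of its complement, results in a graph that has an induced subgraph isomorphic to $H$. A balanced $p$-legged spider of height $q$ is a union of $p$ paths of length $q$ that start at a common vertex $r$ and any two of which have only the vertex $r$ in common; its leaves are its vertices of degree $1$. For $n\ge 3$ let $\mathcal F(n)$ be the class of graphs $H=F\cup T$ that are the union of a graph $F$ with $\dim(F)\le n-1$ and a balanced $(n+1)$-legged spider $T$ of height $n+2$ such that $V(F)\cap V(T)$ is exactly the set of leaves of $T$. **Theorem B.** For every $n\ge 3$ and every $H\in\mathcal F(n)$ there is an integer $k\ge 2$ such that $\square^n K_k$ is $H$-induced-saturated. -/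

import Mathlib

open scoped SimpleGraph

namespace InducedSaturation

universe u w

/-- The Cartesian product of `n` cliques of order `k`: the vertices are the `n`-tuples with entries
in a `k`-element set, two of them being adjacent iff they differ in exactly one coordinate. -/
def hammingGraph (n k : ℕ) : SimpleGraph (Fin n → Fin k) where
  Adj x y := ∃! i, x i ≠ y i
  symm := ⟨fun _ _ h => by simpa only [ne_comm] using h⟩
  loopless := ⟨fun _ h => by
    obtain ⟨_, hi, _⟩ := h
    exact hi rfl⟩

/-- The dimension of a graph: the least `n` such that `G` is isomorphic to an induced subgraph of
the product of `n` cliques of order `k` for some natural number `k`, and `⊤` if there is no such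
`n`. -/
noncomputable def hammingDim {V : Type u} (G : SimpleGraph V) : ℕ∞ :=
  sInf {d : ℕ∞ | ∃ n k : ℕ, d = n ∧ G ⊴ hammingGraph n k}

/-- `G` is `H`-induced-saturated: `G` has no induced subgraph isomorphic to `H`, but deleting any
edge of `G`, or adding to `G` any edge of its complement, creates one. -/
def IsInducedSaturated {W : Type w} {V : Type u} (G : SimpleGraph W) (H : SimpleGraph V) : Prop :=
  ¬ H ⊴ G ∧
  (∀ x y : W, G.Adj x y → H ⊴ G.deleteEdges {s(x, y)}) ∧
  (∀ x y : W, Gᶜ.Adj x y → H ⊴ G ⊔ SimpleGraph.edge x y)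

/-- The subgraph `T` of `H` is a balanced `p`-legged spider of height `q`: it is the union of `p`
paths (legs) of length `q`, all starting at the head `r`, any two of which have only the vertex
`r` in common. -/
def IsBalancedSpider {V : Type u} {H : SimpleGraph V} (T : H.Subgraph) (p q : ℕ) : Prop :=
  ∃ (r : V) (leaf : Fin p → V) (leg : ∀ i, H.Walk r (leaf i)),
    (∀ i, (leg i).IsPath ∧ (leg i).length = q) ∧
    (∀ i j, i ≠ j → (leg i).toSubgraph.verts ∩ (leg j).toSubgraph.verts = {r}) ∧
    T = ⨆ i, (leg i).toSubgraph

/-- The leaves of a subgraph `T`: its vertices that have degree one in `T`. -/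
def leaves {V : Type u} {H : SimpleGraph V} (T : H.Subgraph) : Set V :=
  {v | v ∈ T.verts ∧ (T.neighborSet v).encard = 1}

/-- The class `𝓕(n)`: graphs `H` that are the union of a graph `F` of dimension at most `n - 1` and
a balanced `(n + 1)`-legged spider `T` of height `n + 2` such that the common vertices of `F` and
`T` are exactly the leaves of `T`. -/
def ClassF {V : Type u} (n : ℕ) (H : SimpleGraph V) : Prop :=
  ∃ F T : H.Subgraph,
    F ⊔ T = ⊤ ∧
    hammingDim F.coe ≤ ((n - 1 : ℕ) : ℕ∞) ∧
    IsBalancedSpider T (n + 1) (n + 2) ∧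
    F.verts ∩ T.verts = leaves T

end InducedSaturation

namespace InducedSaturation

universe u

/-! The head of the spider has n + 1 pairwise nonadjacent neighbours, whereas the neighbours of a
vertex of `hammingGraph n k` fall into n cliques, one per coordinate; so H is not induced there.
Changing one edge xy makes room for one more leg. If xy is deleted, the head goes on the line
through x and y, and both x and y serve as necks in that direction. If xy is added, the head goes to
x, and y is a neck besides one neck in each of the n directions.

The rest is routed through fresh letters (`Routing.isIndContained`). F lies in a hyperplane
orthogonal to a coordinate o, with letters that differ everywhere from those of the head, the necks
and the tuples `u l`. Each leg acquires a private letter in o; then its coordinates are replaced one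
by one by those of its foot, o last. The private letters separate the legs in o. A second coordinate
of difference is `κ l` or, when only o is left to change, one in which the feet differ.
`attachSpider_isIndContained_of_special_leg` builds the routing for both kinds of edge, and
`exists_iso_attachSpider` identifies H with an explicit model. -/

/-- Two tuples are far if they differ in at least two coordinates. -/
def Far {ι α : Type*} (x y : ι → α) : Prop := ∃ i j, i ≠ j ∧ x i ≠ y i ∧ x j ≠ y j

theorem Far.symm {ι α : Type*} {x y : ι → α} (h : Far x y) : Far y x := by
  obtain ⟨i, j, hij, hi, hj⟩ := h
  exact ⟨i, j, hij, hi.symm, hj.symm⟩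

theorem Far.ne {ι α : Type*} {x y : ι → α} (h : Far x y) : x ≠ y := by
  obtain ⟨i, j, hij, hi, hj⟩ := h
  rintro rfl
  exact hi rfl

theorem Far.not_adj {n k : ℕ} {x y : Fin n → Fin k} (h : Far x y) :
    ¬ (hammingGraph n k).Adj x y := by
  obtain ⟨i, j, hij, hi, hj⟩ := h
  rintro ⟨l, _, hl⟩
  exact hij ((hl i hi).trans (hl j hj).symm)

theorem hammingGraph_adj_of_iff {n k : ℕ} {x y : Fin n → Fin k} {e : Fin n}
    (h : ∀ i, x i ≠ y i ↔ i = e) : (hammingGraph n k).Adj x y :=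
  ⟨e, (h e).2 rfl, fun i hi => (h i).1 hi⟩

theorem hammingGraph_adj_update {n k : ℕ} {x : Fin n → Fin k} {e : Fin n} {v : Fin k}
    (h : x e ≠ v) : (hammingGraph n k).Adj x (Function.update x e v) := by
  refine hammingGraph_adj_of_iff (e := e) fun i => ?_
  by_cases hi : i = e
  · subst hi; simpa using h
  · simp [hi]

/-! ### An explicit model of a graph with a spider -/

/-- The vertices of a graph on `X` together with a spider whose legs are indexed by `ι` and have
`n + 1` inner vertices each. -/
inductive SpiderVertex (X ι : Type*) (n : ℕ)
  | foot (x : X) : SpiderVertex X ι n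
  | head : SpiderVertex X ι n
  | neck (l : ι) : SpiderVertex X ι n
  | body (l : ι) (t : Fin n) : SpiderVertex X ι n

/-- The edges of `attachSpider`, directed away from the head. -/
def SpiderVertex.rel {X ι : Type*} {n : ℕ} (F : SimpleGraph X) (leaf : ι → X) :
    SpiderVertex X ι n → SpiderVertex X ι n → Prop
  | foot x, foot y => F.Adj x y
  | head, neck _ => True
  | neck l, body l' t => l = l' ∧ (t : ℕ) = 0
  | body l t, body l' t' => l = l' ∧ (t : ℕ) + 1 = t'
  | body l t, foot x => x = leaf l ∧ (t : ℕ) + 1 = n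
  | _, _ => False

/-- The graph `F` with a spider of height `n + 2` attached whose leaves are the vertices
`leaf l`. -/
def attachSpider {X ι : Type*} (n : ℕ) (F : SimpleGraph X) (leaf : ι → X) :
    SimpleGraph (SpiderVertex X ι n) where
  Adj a b := SpiderVertex.rel F leaf a b ∨ SpiderVertex.rel F leaf b a
  symm := ⟨fun _ _ h => h.symm⟩
  loopless := ⟨fun a h => by cases a <;> simp [SpiderVertex.rel] at h⟩

open SpiderVertex

/-! ### Routing the legs through the Hamming graph -/

/-- Positions in `Fin n → Fin k` for the vertices of a spider attached to a graph. The legs go from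
the head `r` over `s l` and `u l` to a vertex of the graph, changing the coordinates one by one, the
coordinate `κ l` last but one and the coordinate `o` last. -/
structure Routing (n k : ℕ) (X ι : Type*) where
  f : X → Fin n → Fin k
  leaf : ι → X
  o : Fin n
  r : Fin n → Fin k
  s : ι → Fin n → Fin k
  u : ι → Fin n → Fin k
  κ : ι → Fin n
  pos : ι → Equiv.Perm (Fin n)
  three_le : 3 ≤ n
  leaf_injective : Function.Injective leaf
  f_o : ∀ x y, f x o = f y o
  f_injective : Function.Injective f
  f_ne_r : ∀ x i, f x i ≠ r i
  f_ne_s : ∀ x l i, f x i ≠ s l i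
  f_ne_u : ∀ x l i, f x i ≠ u l i
  -- The letters of `u l` in `o` and `κ l` distinguish leg `l` from the head and from the necks and
  -- starting points `u l'` of all other legs.
  r_o : ∀ l, r o ≠ u l o
  u_o : ∀ l l', l ≠ l' → u l o ≠ u l' o
  s_o : ∀ l l', l ≠ l' → s l o ≠ u l' o
  κ_ne : ∀ l, κ l ≠ o
  r_κ : ∀ l, r (κ l) ≠ u l (κ l)
  u_κ : ∀ l l', l ≠ l' → u l' (κ l) ≠ u l (κ l)
  s_κ : ∀ l l', l ≠ l' → s l' (κ l) ≠ u l (κ l)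
  -- Restricting `e` to the two coordinates that are changed last ensures that the first change
  -- along the leg happens elsewhere.
  s_u : ∀ l, ∃ e, (e = o ∨ e = κ l) ∧ ∀ i, s l i ≠ u l i ↔ i = e
  pos_o : ∀ l, (pos l o : ℕ) + 1 = n
  pos_κ : ∀ l, (pos l (κ l) : ℕ) + 2 = n

namespace Routing

variable {n k : ℕ} {X ι : Type*} (R : Routing n k X ι)

/-- The `t`-th vertex on the way from `u l` to the foot of the leg. -/
def mid (l : ι) (t : ℕ) : Fin n → Fin k := fun i =>
  if (R.pos l i : ℕ) < t then R.f (R.leaf l) i else R.u l i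

theorem mid_of_lt {l : ι} {t : ℕ} {i : Fin n} (h : (R.pos l i : ℕ) < t) :
    R.mid l t i = R.f (R.leaf l) i := if_pos h

theorem mid_of_le {l : ι} {t : ℕ} {i : Fin n} (h : t ≤ (R.pos l i : ℕ)) :
    R.mid l t i = R.u l i := if_neg h.not_gt

theorem mid_zero (l : ι) : R.mid l 0 = R.u l := funext fun _ => R.mid_of_le (Nat.zero_le _)

theorem mid_card (l : ι) : R.mid l n = R.f (R.leaf l) := funext fun i => R.mid_of_lt (R.pos l i).2

theorem mid_o {l : ι} {t : ℕ} (ht : t < n) : R.mid l t R.o = R.u l R.o :=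
  R.mid_of_le (by have := R.pos_o l; omega)

theorem mid_κ {l : ι} {t : ℕ} (ht : t + 1 < n) : R.mid l t (R.κ l) = R.u l (R.κ l) :=
  R.mid_of_le (by have := R.pos_κ l; omega)

theorem mid_last {l : ι} {t : ℕ} (ht : t + 1 = n) {i : Fin n} (hi : i ≠ R.o) :
    R.mid l t i = R.f (R.leaf l) i := by
  refine R.mid_of_lt ?_
  have h1 := R.pos_o l
  have h2 : (R.pos l i : ℕ) ≠ R.pos l R.o := fun h => hi ((R.pos l).injective (Fin.ext h))
  have h3 := (R.pos l i).2
  omega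

theorem mid_mem (l : ι) (t : ℕ) (i : Fin n) :
    R.mid l t i = R.f (R.leaf l) i ∨ R.mid l t i = R.u l i := by
  by_cases h : (R.pos l i : ℕ) < t
  · exact Or.inl (R.mid_of_lt h)
  · exact Or.inr (R.mid_of_le (not_lt.1 h))

theorem adj_mid_succ {l : ι} {t : ℕ} (ht : t < n) :
    (hammingGraph n k).Adj (R.mid l t) (R.mid l (t + 1)) := by
  refine hammingGraph_adj_of_iff (e := (R.pos l).symm ⟨t, ht⟩) fun i => ?_
  have hi : i = (R.pos l).symm ⟨t, ht⟩ ↔ (R.pos l i : ℕ) = t := by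
    rw [Equiv.eq_symm_apply, Fin.ext_iff]
  rw [hi]
  rcases lt_trichotomy (R.pos l i : ℕ) t with h | h | h
  · rw [R.mid_of_lt h, R.mid_of_lt (by omega)]; simp [h.ne]
  · rw [R.mid_of_le (by omega), R.mid_of_lt (by omega)]; simp [h, (R.f_ne_u _ _ _).symm]
  · rw [R.mid_of_le (by omega), R.mid_of_le (by omega)]; simp [h.ne']

theorem far_mid_mid {l : ι} {t t' : ℕ} (h : t + 2 ≤ t') (h' : t' ≤ n) :
    Far (R.mid l t) (R.mid l t') := by
  refine ⟨(R.pos l).symm ⟨t, by omega⟩, (R.pos l).symm ⟨t + 1, by omega⟩, by simp, ?_, ?_⟩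
  all_goals
    rw [R.mid_of_le (by simp), R.mid_of_lt (by simp; omega)]
    exact (R.f_ne_u _ _ _).symm

/-- In `κ l` the leg only ever shows the letter of `u l` or that of its foot, so avoiding both
suffices whatever `t` is. -/
theorem far_mid_of_ne {l : ι} {t : ℕ} (ht : t < n) {w : Fin n → Fin k} (ho : w R.o ≠ R.u l R.o)
    (hκ : w (R.κ l) ≠ R.u l (R.κ l)) (hf : R.f (R.leaf l) (R.κ l) ≠ w (R.κ l)) :
    Far (R.mid l t) w := by
  refine ⟨R.o, R.κ l, (R.κ_ne l).symm, by rw [R.mid_o ht]; exact ho.symm, ?_⟩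
  rcases R.mid_mem l t (R.κ l) with h | h <;> rw [h]
  · exact hf
  · exact hκ.symm

theorem exists_f_ne {x y : X} (h : x ≠ y) : ∃ i, i ≠ R.o ∧ R.f x i ≠ R.f y i := by
  obtain ⟨i, hi⟩ := Function.ne_iff.1 (R.f_injective.ne h)
  exact ⟨i, fun h => hi (h ▸ R.f_o x y), hi⟩

/-- Before the last change both `o` and `κ l` still carry letters of `u l`. With only `o` left to
change, the tuple agrees with its own foot outside `o`, and two feet differ outside `o`. -/
theorem far_mid_foot {l : ι} {t : ℕ} (ht : t < n) {x : X} (hx : x ≠ R.leaf l) :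
    Far (R.mid l t) (R.f x) := by
  by_cases h : t + 1 = n
  · obtain ⟨i, hi, hne⟩ := R.exists_f_ne hx
    exact ⟨R.o, i, hi.symm, by rw [R.mid_o ht]; exact (R.f_ne_u _ _ _).symm,
      by rw [R.mid_last h hi]; exact hne.symm⟩
  · exact ⟨R.o, R.κ l, (R.κ_ne l).symm, by rw [R.mid_o ht]; exact (R.f_ne_u _ _ _).symm,
      by rw [R.mid_κ (by omega)]; exact (R.f_ne_u _ _ _).symm⟩

/-- The legs differ in `o`. If one of them has not yet changed its own `κ`, that is the second
coordinate; otherwise both agree with their distinct feet outside `o`. -/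
theorem far_mid_mid_of_ne {l l' : ι} (hl : l ≠ l') {t t' : ℕ} (ht : t < n) (ht' : t' < n) :
    Far (R.mid l t) (R.mid l' t') := by
  have key : ∀ {l l' : ι}, l ≠ l' → ∀ {t t' : ℕ}, t + 1 < n → t' < n →
      Far (R.mid l t) (R.mid l' t') := by
    intro l l' hl t t' ht ht'
    refine ⟨R.o, R.κ l, (R.κ_ne l).symm, ?_, ?_⟩
    · rw [R.mid_o ht', R.mid_o (by omega)]; exact R.u_o l l' hl
    · rw [R.mid_κ ht]
      rcases R.mid_mem l' t' (R.κ l) with h | h <;> rw [h]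
      · exact (R.f_ne_u _ _ _).symm
      · exact (R.u_κ l l' hl).symm
  by_cases h : t + 1 < n
  · exact key hl h ht'
  by_cases h' : t' + 1 < n
  · exact (key hl.symm h' ht).symm
  obtain ⟨i, hi, hne⟩ := R.exists_f_ne (R.leaf_injective.ne hl)
  refine ⟨R.o, i, hi.symm, ?_, ?_⟩
  · rw [R.mid_o ht', R.mid_o ht]; exact R.u_o l l' hl
  · rwa [R.mid_last (by omega) hi, R.mid_last (by omega) hi]

theorem far_foot_of_ne (x : X) {w : Fin n → Fin k} (h : ∀ i, R.f x i ≠ w i) : Far (R.f x) w := by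
  have := R.three_le
  exact ⟨⟨0, by omega⟩, ⟨1, by omega⟩, by simp, h _, h _⟩

theorem far_mid_head {l : ι} {t : ℕ} (ht : t < n) : Far (R.mid l t) R.r :=
  R.far_mid_of_ne ht (R.r_o l) (R.r_κ l) (R.f_ne_r _ _)

theorem far_mid_neck_of_ne {l l' : ι} (hl : l ≠ l') {t : ℕ} (ht : t < n) :
    Far (R.mid l t) (R.s l') :=
  R.far_mid_of_ne ht (R.s_o l' l hl.symm) (R.s_κ l l' hl) (R.f_ne_s _ _ _)

theorem adj_neck_mid (l : ι) : (hammingGraph n k).Adj (R.s l) (R.mid l 0) := by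
  obtain ⟨e, -, h⟩ := R.s_u l
  rw [R.mid_zero]
  exact hammingGraph_adj_of_iff h

/-- The coordinate at position 0 already shows the letter of the foot. It is not `e`, since `o` and
`κ l` have positions n - 1 and n - 2 and 3 ≤ n. In `e`, both the foot and `u l` differ from `s l`.
-/
theorem far_mid_neck {l : ι} {t : ℕ} (ht : 1 ≤ t) : Far (R.mid l t) (R.s l) := by
  have hn := R.three_le
  obtain ⟨e, he, h⟩ := R.s_u l
  refine ⟨e, (R.pos l).symm ⟨0, by omega⟩, ?_, ?_, ?_⟩
  · rw [Ne, Equiv.eq_symm_apply, Fin.ext_iff]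
    have h1 := R.pos_o l
    have h2 := R.pos_κ l
    rcases he with rfl | rfl <;> dsimp only <;> omega
  · rcases R.mid_mem l t e with h' | h' <;> rw [h']
    · exact R.f_ne_s _ _ _
    · exact ((h e).2 rfl).symm
  · rw [R.mid_of_lt (by simp; omega)]
    exact R.f_ne_s _ _ _

theorem mid_ne_neck {l l' : ι} {t : ℕ} (ht : t < n) : R.mid l t ≠ R.s l' := by
  by_cases hl : l = l'
  · subst hl
    rcases Nat.eq_zero_or_pos t with rfl | h
    · exact (R.adj_neck_mid l).ne'
    · exact (R.far_mid_neck h).ne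
  · exact (R.far_mid_neck_of_ne hl ht).ne

/-- The position of a vertex. -/
def place : SpiderVertex X ι n → Fin n → Fin k
  | foot x => R.f x
  | head => R.r
  | neck l => R.s l
  | body l t => R.mid l t

/-- A routing embeds the graph with its spider into any graph that differs from the Hamming graph
only between the head and the first vertices of the legs, where it is as required. -/
theorem isIndContained {F : SimpleGraph X}
    (hF : ∀ x y, F.Adj x y ↔ (hammingGraph n k).Adj (R.f x) (R.f y))
    {G : SimpleGraph (Fin n → Fin k)}
    (hG : ∀ v w, v ≠ R.r → (∀ l, v ≠ R.s l) → (G.Adj v w ↔ (hammingGraph n k).Adj v w))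
    (hr : ∀ l, G.Adj R.r (R.s l))
    (hs : ∀ l l', l ≠ l' → R.s l ≠ R.s l' ∧ ¬ G.Adj (R.s l) (R.s l')) :
    attachSpider n F R.leaf ⊴ G := by
  set A := attachSpider n F R.leaf with hA
  have far_foot_r x : Far (R.f x) R.r := R.far_foot_of_ne x (R.f_ne_r x)
  have far_foot_s x l : Far (R.f x) (R.s l) := R.far_foot_of_ne x (R.f_ne_s x l)
  have hGf x w : G.Adj (R.f x) w ↔ (hammingGraph n k).Adj (R.f x) w :=
    hG _ _ (far_foot_r x).ne fun l => (far_foot_s x l).ne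
  have hGm l (t : Fin n) w : G.Adj (R.mid l t) w ↔ (hammingGraph n k).Adj (R.mid l t) w :=
    hG _ _ (R.far_mid_head t.2).ne fun l' => R.mid_ne_neck t.2
  -- `P` for all pairs gives injectivity and the induced embedding at once; being symmetric, it
  -- needs only one order of each pair of vertex types.
  let P (a b : SpiderVertex X ι n) : Prop :=
    (A.Adj a b → G.Adj (R.place a) (R.place b)) ∧
    (¬ A.Adj a b → a ≠ b → R.place a ≠ R.place b ∧ ¬ G.Adj (R.place a) (R.place b))
  have symm : ∀ a b, P a b → P b a := by
    intro a b h
    refine ⟨fun hab => (h.1 hab.symm).symm, fun hab hne => ?_⟩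
    have := h.2 (fun h' => hab h'.symm) hne.symm
    exact ⟨this.1.symm, fun h' => this.2 h'.symm⟩
  have far : ∀ a b, ¬ A.Adj a b → Far (R.place a) (R.place b) →
      (G.Adj (R.place a) (R.place b) ↔ (hammingGraph n k).Adj (R.place a) (R.place b)) →
      P a b := fun a b hab hf hg =>
    ⟨fun h => absurd h hab, fun _ _ => ⟨hf.ne, fun h => hf.not_adj (hg.1 h)⟩⟩
  have near : ∀ a b, A.Adj a b → G.Adj (R.place a) (R.place b) → P a b := fun a b hab hg =>
    ⟨fun _ => hg, fun h => absurd hab h⟩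
  have refl : ∀ a, P a a := fun a => ⟨fun h => absurd h A.irrefl, fun _ h => absurd rfl h⟩
  have bb : ∀ l (t t' : Fin n), (t : ℕ) < t' → P (body l t) (body l t') := by
    intro l t t' h
    by_cases h1 : (t : ℕ) + 1 = t'
    · refine near _ _ (by simp [hA, attachSpider, rel, h1]) ((hGm _ _ _).2 ?_)
      have := R.adj_mid_succ (l := l) t.2
      rwa [h1] at this
    · exact far _ _ (by simp [hA, attachSpider, rel]; omega)
        (R.far_mid_mid (by omega) t'.2.le) (hGm _ _ _)
  have main : ∀ a b, P a b := by
    have fr : ∀ x, P (foot x) head := fun x =>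
      far _ _ (by simp [hA, attachSpider, rel]) (far_foot_r x) (hGf _ _)
    have fs : ∀ x l, P (foot x) (neck l) := fun x l =>
      far _ _ (by simp [hA, attachSpider, rel]) (far_foot_s x l) (hGf _ _)
    have bf : ∀ l t x, P (body l t) (foot x) := by
      intro l t x
      by_cases hx : x = R.leaf l
      · subst hx
        by_cases h1 : (t : ℕ) + 1 = n
        · refine near _ _ (by simp [hA, attachSpider, rel, h1]) ((hGm _ _ _).2 ?_)
          have := R.adj_mid_succ (l := l) t.2
          rwa [h1, R.mid_card] at this
        · refine far _ _ (by simp [hA, attachSpider, rel, h1]) ?_ (hGm _ _ _)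
          have := R.far_mid_mid (l := l) (t := t) (t' := n) (by omega) le_rfl
          rwa [R.mid_card] at this
      · exact far _ _ (by simp [hA, attachSpider, rel, hx]) (R.far_mid_foot t.2 hx) (hGm _ _ _)
    have rs : ∀ l, P head (neck l) := fun l =>
      near _ _ (by simp [hA, attachSpider, rel]) (hr l)
    have br : ∀ l t, P (body l t) head := fun l t =>
      far _ _ (by simp [hA, attachSpider, rel]) (R.far_mid_head t.2) (hGm _ _ _)
    have bs : ∀ l t l', P (body l t) (neck l') := by
      intro l t l'
      by_cases hl : l = l'
      · subst hl
        rcases Nat.eq_zero_or_pos (t : ℕ) with h | h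
        · refine near _ _ (by simp [hA, attachSpider, rel, h]) ((hGm _ _ _).2 ?_)
          have := R.adj_neck_mid l
          rw [← h] at this
          exact this.symm
        · exact far _ _ (by simp [hA, attachSpider, rel]; omega) (R.far_mid_neck h) (hGm _ _ _)
      · exact far _ _ (by simp [hA, attachSpider, rel, Ne.symm hl])
          (R.far_mid_neck_of_ne hl t.2) (hGm _ _ _)
    rintro (x | - | l | ⟨l, t⟩) (y | - | l' | ⟨l', t'⟩)
    · refine ⟨fun h => (hGf _ _).2 ((hF _ _).1 ?_), fun h hne => ⟨?_, fun h' => h ?_⟩⟩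
      · simpa [hA, attachSpider, rel, F.adj_comm y x] using h
      · exact R.f_injective.ne fun h => hne (h ▸ rfl)
      · simpa [hA, attachSpider, rel, F.adj_comm y x] using (hF _ _).2 ((hGf _ _).1 h')
    · exact fr x
    · exact fs x l'
    · exact symm _ _ (bf _ _ _)
    · exact symm _ _ (fr _)
    · exact refl _
    · exact rs _
    · exact symm _ _ (br _ _)
    · exact symm _ _ (fs _ _)
    · exact symm _ _ (rs _)
    · exact ⟨fun h => by simp [hA, attachSpider, rel] at h, fun _ hne =>
        hs _ _ fun h => hne (h ▸ rfl)⟩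
    · exact symm _ _ (bs _ _ _)
    · exact bf _ _ _
    · exact br _ _
    · exact bs _ _ _
    · by_cases hl : l = l'
      · subst hl
        rcases lt_trichotomy (t : ℕ) t' with h | h | h
        · exact bb _ _ _ h
        · rw [Fin.ext h]; exact refl _
        · exact symm _ _ (bb _ _ _ h)
      · exact far _ _ (by simp [hA, attachSpider, rel, hl, Ne.symm hl])
          (R.far_mid_mid_of_ne hl t.2 t'.2) (hGm _ _ _)
  refine ⟨⟨⟨R.place, fun a b hab => ?_⟩, fun {a b} => ?_⟩⟩
  · by_contra hne
    by_cases h : A.Adj a b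
    · exact ((main a b).1 h).ne hab
    · exact ((main a b).2 h hne).1 hab
  · refine ⟨fun h => ?_, (main a b).1⟩
    by_contra hA'
    by_cases hne : a = b
    · subst hne; exact G.irrefl h
    · exact ((main a b).2 hA' hne).2 h

end Routing

/-! ### The spider does not fit into the Hamming graph -/

/-- Dimension `n` excludes `n + 1` pairwise nonadjacent neighbours of a vertex. -/
theorem not_attachSpider_isIndContained {n k : ℕ} {X ι : Type*} [Fintype ι]
    (hι : n < Fintype.card ι) (F : SimpleGraph X) (leaf : ι → X) :
    ¬ attachSpider n F leaf ⊴ hammingGraph n k := by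
  rintro ⟨φ⟩
  have hadj l : (hammingGraph n k).Adj (φ head) (φ (neck l)) :=
    φ.map_adj_iff.2 (by simp [attachSpider, rel])
  choose c hc hc' using hadj
  -- Two necks that leave the head in the same coordinate agree in all others and hence are
  -- adjacent.
  obtain ⟨l, l', hl, hcl⟩ := Fintype.exists_ne_map_eq_of_card_lt c (by simpa using hι)
  have hne : φ (neck l) ≠ φ (neck l') := φ.injective.ne (by simpa using hl)
  have heq : ∀ i, φ (neck l) i ≠ φ (neck l') i → i = c l := by
    intro i hi
    by_contra h
    have h1 : φ head i = φ (neck l) i := by_contra fun h' => h (hc' l i h')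
    have h2 : φ head i = φ (neck l') i := by_contra fun h' => h (hcl ▸ hc' l' i h')
    exact hi (h1.symm.trans h2)
  obtain ⟨i, hi⟩ := Function.ne_iff.1 hne
  have : (attachSpider n F leaf).Adj (neck l) (neck l') :=
    φ.map_adj_iff.1 ⟨c l, heq i hi ▸ hi, heq⟩
  simp [attachSpider, rel] at this

/-! ### From subgraphs to the explicit model -/

/-- A graph that is the union of two subgraphs, the second of which is a balanced spider meeting the
first in its leaves, is the first one with a spider attached. -/
theorem exists_iso_attachSpider {V : Type u} {H : SimpleGraph V} {F T : H.Subgraph} {p n : ℕ}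
    (hp : 2 ≤ p) (hn : 0 < n) (hFT : F ⊔ T = ⊤) (hT : IsBalancedSpider T p (n + 2))
    (hleaves : F.verts ∩ T.verts = leaves T) {ι : Type*} (E : ι ≃ Fin p) :
    ∃ leaf : ι → F.verts, Function.Injective leaf ∧
      Nonempty (H ≃g attachSpider n F.coe leaf) := by
  obtain ⟨r, leaf, leg, hleg, hmeet, rfl⟩ := hT
  set T : H.Subgraph := ⨆ i, (leg i).toSubgraph with hTdef
  have mem_verts : ∀ i v, v ∈ (leg i).toSubgraph.verts ↔ ∃ t ≤ n + 2, (leg i).getVert t = v := by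
    intro i v
    rw [SimpleGraph.Walk.mem_verts_toSubgraph, SimpleGraph.Walk.mem_support_iff_exists_getVert,
      (hleg i).2]
    exact exists_congr fun t => and_comm
  have inj_same : ∀ i t t', t ≤ n + 2 → t' ≤ n + 2 →
      (leg i).getVert t = (leg i).getVert t' → t = t' := by
    intro i t t' ht ht' h
    exact (hleg i).1.getVert_injOn (by simpa [(hleg i).2] using ht)
      (by simpa [(hleg i).2] using ht') h
  -- Distinct legs share only `r`, which a path visits only at index 0, so a common vertex has the
  -- same index on both legs.
  have inj : ∀ i j t t', t ≤ n + 2 → t' ≤ n + 2 → (leg i).getVert t = (leg j).getVert t' →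
      t = t' ∧ (i = j ∨ t = 0) := by
    intro i j t t' ht ht' h
    by_cases hij : i = j
    · subst hij
      exact ⟨inj_same i t t' ht ht' h, Or.inl rfl⟩
    · have hr : (leg i).getVert t = r := by
        have : (leg i).getVert t ∈ ({r} : Set V) := by
          rw [← hmeet i j hij]
          exact ⟨(mem_verts i _).2 ⟨t, ht, rfl⟩, (mem_verts j _).2 ⟨t', ht', h.symm⟩⟩
        exact this
      have h0 : t = 0 := inj_same i t 0 ht (by omega) (by simpa using hr)
      have h0' : t' = 0 := inj_same j t' 0 ht' (by omega) (by simpa [← h] using hr)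
      exact ⟨h0.trans h0'.symm, Or.inr h0⟩
  have hTadj : ∀ v w, T.Adj v w ↔ ∃ i t, t < n + 2 ∧
      ((leg i).getVert t = v ∧ (leg i).getVert (t + 1) = w ∨
        (leg i).getVert t = w ∧ (leg i).getVert (t + 1) = v) := by
    intro v w
    rw [hTdef, SimpleGraph.Subgraph.iSup_adj]
    refine exists_congr fun i => ?_
    rw [SimpleGraph.Walk.toSubgraph_adj_iff, (hleg i).2]
    refine exists_congr fun t => ?_
    rw [Sym2.eq_iff, and_comm]
  have hTverts : ∀ v, v ∈ T.verts ↔ ∃ i t, t ≤ n + 2 ∧ (leg i).getVert t = v := by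
    intro v
    rw [hTdef, SimpleGraph.Subgraph.verts_iSup, Set.mem_iUnion]
    exact exists_congr fun i => mem_verts i v
  have adj_step : ∀ i t, t < n + 2 → T.Adj ((leg i).getVert t) ((leg i).getVert (t + 1)) :=
    fun i t ht => (hTadj _ _).2 ⟨i, t, ht, Or.inl ⟨rfl, rfl⟩⟩
  have two_nbrs : ∀ v a b, T.Adj v a → T.Adj v b → a ≠ b → v ∉ leaves T := by
    rintro v a b ha hb hab ⟨-, h⟩
    obtain ⟨x, hx⟩ := Set.encard_eq_one.1 h
    have h1 : a ∈ T.neighborSet v := ha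
    have h2 : b ∈ T.neighborSet v := hb
    rw [hx] at h1 h2
    exact hab (h1.trans h2.symm)
  have not_leaf : ∀ i t, t < n + 2 → (leg i).getVert t ∉ leaves T := by
    intro i t ht
    rcases Nat.eq_zero_or_pos t with rfl | h0
    · let i₀ : Fin p := ⟨0, by omega⟩
      let i₁ : Fin p := ⟨1, by omega⟩
      have h₀ := adj_step i₀ 0 (by omega)
      have h₁ := adj_step i₁ 0 (by omega)
      rw [SimpleGraph.Walk.getVert_zero] at h₀ h₁ ⊢
      refine two_nbrs _ _ _ h₀ h₁ fun h => ?_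
      have := (inj _ _ _ _ (by omega) (by omega) h).2
      simp [i₀, i₁] at this
    · obtain ⟨t, rfl⟩ : ∃ t', t = t' + 1 := ⟨t - 1, by omega⟩
      refine two_nbrs _ _ _ (adj_step i t (by omega)).symm (adj_step i (t + 1) ht) fun h => ?_
      have := (inj _ _ _ _ (by omega) (by omega) h).1
      omega
  have isLeaf : ∀ i, (leg i).getVert (n + 2) ∈ leaves T := by
    intro i
    refine ⟨(hTverts _).2 ⟨i, _, le_rfl, rfl⟩, Set.encard_eq_one.2 ⟨(leg i).getVert (n + 1), ?_⟩⟩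
    ext w
    rw [SimpleGraph.Subgraph.mem_neighborSet, hTadj, Set.mem_singleton_iff]
    constructor
    · rintro ⟨j, t, ht, ⟨h1, -⟩ | ⟨h1, h2⟩⟩
      · have := (inj _ _ _ _ (by omega) (by omega) h1).1
        omega
      · obtain ⟨h3, h4 | h4⟩ := inj _ _ _ _ (by omega) (by omega) h2
        · subst h4
          rw [← h1, show t = n + 1 by omega]
        · omega
    · rintro rfl
      exact ⟨i, n + 1, by omega, Or.inr ⟨rfl, rfl⟩⟩
  have foot_mem : ∀ i, (leg i).getVert (n + 2) ∈ F.verts := fun i => by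
    have := isLeaf i
    rw [← hleaves] at this
    exact this.1
  have inner_not_mem : ∀ i t, t < n + 2 → (leg i).getVert t ∉ F.verts := fun i t ht h =>
    not_leaf i t ht (hleaves ▸ ⟨h, (hTverts _).2 ⟨i, t, ht.le, rfl⟩⟩)
  have hadj : ∀ v w, H.Adj v w ↔ F.Adj v w ∨ T.Adj v w := fun v w => by
    rw [← SimpleGraph.Subgraph.sup_adj, hFT, SimpleGraph.Subgraph.top_adj]
  have hverts : ∀ v, v ∈ F.verts ∨ v ∈ T.verts := fun v => by
    have : v ∈ (F ⊔ T).verts := by rw [hFT]; trivial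
    exact this
  let L : ι → F.verts := fun l => ⟨(leg (E l)).getVert (n + 2), foot_mem (E l)⟩
  let ψ : SpiderVertex F.verts ι n → V
    | foot x => x
    | head => r
    | neck l => (leg (E l)).getVert 1
    | body l t => (leg (E l)).getVert (t + 2)
  have ψ_head : ∀ i, ψ head = (leg i).getVert 0 := fun i => by simp [ψ]
  have ψ_inj : Function.Injective ψ := by
    have i₀ : Fin p := ⟨0, by omega⟩
    have hf : ∀ x : F.verts, ∀ i t, t < n + 2 → (x : V) ≠ (leg i).getVert t := by
      intro x i t ht h
      exact inner_not_mem i t ht (h ▸ x.2)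
    rintro (x | - | l | ⟨l, t⟩) (y | - | l' | ⟨l', t'⟩) h
    · exact congrArg foot (Subtype.ext h)
    · exact absurd (h.trans (ψ_head i₀)) (hf _ _ _ (by omega))
    · exact absurd h (hf _ _ _ (by omega))
    · exact absurd h (hf _ _ _ (by omega))
    · exact absurd (h.symm.trans (ψ_head i₀)) (hf _ _ _ (by omega))
    · rfl
    · have := (inj _ _ _ _ (by omega) (by omega) ((ψ_head i₀).symm.trans h)).1
      omega
    · have := (inj _ _ _ _ (by omega) (by omega) ((ψ_head i₀).symm.trans h)).1
      omega
    · exact absurd h.symm (hf _ _ _ (by omega))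
    · have := (inj _ _ _ _ (by omega) (by omega) ((ψ_head i₀).symm.trans h.symm)).1
      omega
    · obtain ⟨-, h | h⟩ := inj _ _ _ _ (by omega) (by omega) h
      · rw [E.injective h]
      · omega
    · have := (inj _ _ _ _ (by omega) (by omega) h).1
      omega
    · exact absurd h.symm (hf _ _ _ (by omega))
    · have := (inj _ _ _ _ (by omega) (by omega) ((ψ_head i₀).symm.trans h.symm)).1
      omega
    · have := (inj _ _ _ _ (by omega) (by omega) h).1
      omega
    · obtain ⟨h1, h | h⟩ := inj _ _ _ _ (by omega) (by omega) h
      · rw [E.injective h, Fin.ext (Nat.add_right_cancel h1)]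
      · omega
  have on_leg : ∀ i t, t ≤ n + 2 → ∃ a, ψ a = (leg i).getVert t := by
    intro i t ht
    obtain ⟨l, rfl⟩ := E.surjective i
    rcases t with _ | _ | t
    · exact ⟨head, ψ_head _⟩
    · exact ⟨neck l, rfl⟩
    · by_cases h : t < n
      · exact ⟨body l ⟨t, h⟩, rfl⟩
      · refine ⟨foot (L l), ?_⟩
        rw [show t = n by omega]
  have ψ_surj : Function.Surjective ψ := by
    intro v
    rcases hverts v with h | h
    · exact ⟨foot ⟨v, h⟩, rfl⟩
    · obtain ⟨i, t, ht, rfl⟩ := (hTverts v).1 h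
      exact on_leg i t ht
  have rel_adj : ∀ a b, rel F.coe L a b → H.Adj (ψ a) (ψ b) := by
    rintro (x | - | l | ⟨l, t⟩) (y | - | l' | ⟨l', t'⟩) h <;>
      simp only [rel] at h
    · exact F.adj_sub h
    · rw [ψ_head (E l')]
      exact T.adj_sub (adj_step _ 0 (by omega))
    · obtain ⟨rfl, h⟩ := h
      have := T.adj_sub (adj_step (E l) 1 (by omega))
      simpa [ψ, h] using this
    · obtain ⟨rfl, h⟩ := h
      have := T.adj_sub (adj_step (E l) (t + 2) (by omega))
      simpa [ψ, L, show (t : ℕ) + 2 + 1 = n + 2 by omega] using this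
    · obtain ⟨rfl, h⟩ := h
      have := T.adj_sub (adj_step (E l) (t + 2) (by omega))
      simpa [ψ, ← h, show (t : ℕ) + 2 + 1 = t + 1 + 2 by omega] using this
  have step_rel : ∀ i t, t < n + 2 → ∀ a b, ψ a = (leg i).getVert t →
      ψ b = (leg i).getVert (t + 1) → rel F.coe L a b := by
    intro i t ht
    obtain ⟨l, rfl⟩ := E.surjective i
    -- As `ψ` is injective, it is enough to exhibit one related pair above each edge of a leg.
    have key : ∀ a' b', rel F.coe L a' b' → ψ a' = (leg (E l)).getVert t →
        ψ b' = (leg (E l)).getVert (t + 1) → ∀ a b, ψ a = (leg (E l)).getVert t →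
        ψ b = (leg (E l)).getVert (t + 1) → rel F.coe L a b := by
      intro a' b' h ha' hb' a b ha hb
      rwa [ψ_inj (ha.trans ha'.symm), ψ_inj (hb.trans hb'.symm)]
    rcases t with _ | _ | t
    · exact key head (neck l) trivial (ψ_head _) rfl
    · exact key (neck l) (body l ⟨0, hn⟩) ⟨rfl, rfl⟩ rfl rfl
    · by_cases h : t + 1 = n
      · exact key (body l ⟨t, by omega⟩) (foot (L l)) ⟨rfl, h⟩ rfl (by simp [ψ, L, ← h])
      · exact key (body l ⟨t, by omega⟩) (body l ⟨t + 1, by omega⟩) ⟨rfl, rfl⟩ rfl rfl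
  refine ⟨L, fun l l' h => ?_, ⟨RelIso.symm ⟨Equiv.ofBijective ψ ⟨ψ_inj, ψ_surj⟩, ?_⟩⟩⟩
  · obtain ⟨-, h | h⟩ := inj _ _ _ _ le_rfl le_rfl (congrArg Subtype.val h)
    · exact E.injective h
    · omega
  · intro a b
    change H.Adj (ψ a) (ψ b) ↔ rel F.coe L a b ∨ rel F.coe L b a
    refine ⟨fun h => ?_, fun h => h.elim (rel_adj a b) fun h => (rel_adj b a h).symm⟩
    rcases (hadj _ _).1 h with h | h
    · obtain ⟨x, hx⟩ : ∃ x, a = foot x := ⟨⟨ψ a, h.fst_mem⟩, ψ_inj rfl⟩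
      obtain ⟨y, hy⟩ : ∃ y, b = foot y := ⟨⟨ψ b, h.snd_mem⟩, ψ_inj rfl⟩
      subst hx hy
      exact Or.inl h
    · obtain ⟨i, t, ht, ⟨h1, h2⟩ | ⟨h1, h2⟩⟩ := (hTadj _ _).1 h
      · exact Or.inl (step_rel i t ht a b h1.symm h2.symm)
      · exact Or.inr (step_rel i t ht b a h1.symm h2.symm)

/-! ### Placing F in a hyperplane -/

theorem hammingGraph_adj_or_far {n k : ℕ} {x y : Fin n → Fin k} (h : x ≠ y) :
    (hammingGraph n k).Adj x y ∨ Far x y := by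
  obtain ⟨i, hi⟩ := Function.ne_iff.1 h
  by_cases h' : ∃ j, j ≠ i ∧ x j ≠ y j
  · obtain ⟨j, hj, hxy⟩ := h'
    exact Or.inr ⟨i, j, hj.symm, hi, hxy⟩
  · push Not at h'
    exact Or.inl ⟨i, hi, fun j hj => by_contra fun h => hj (h' j h)⟩

theorem exists_isIndContained_of_hammingDim_le {X : Type*} {F : SimpleGraph X} {d : ℕ}
    (h : hammingDim F ≤ d) : ∃ d' ≤ d, ∃ m, F ⊴ hammingGraph d' m := by
  unfold hammingDim at h
  set S := {d : ℕ∞ | ∃ n k : ℕ, d = n ∧ F ⊴ hammingGraph n k}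
  -- An empty set would have infimum `⊤`, against the finite bound; a nonempty one attains its
  -- infimum.
  have hS : S.Nonempty := by
    by_contra hS
    rw [Set.not_nonempty_iff_eq_empty.1 hS, sInf_empty] at h
    simp at h
  obtain ⟨d', m, hd, hF⟩ := csInf_mem hS
  rw [hd] at h
  exact ⟨d', by exact_mod_cast h, m, hF⟩

/-- A graph of dimension less than `n` embeds into a hyperplane orthogonal to any coordinate `o`,
with arbitrarily chosen alphabets. -/
theorem exists_hyperplane_embedding {X : Type*} {F : SimpleGraph X} {d m n k : ℕ}
    (hF : F ⊴ hammingGraph d m) (hd : d < n) (o : Fin n) (φ : Fin n → Option (Fin m) → Fin k)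
    (hφ : ∀ i, Function.Injective (φ i)) :
    ∃ f : X → Fin n → Fin k, Function.Injective f ∧
      (∀ x y, F.Adj x y ↔ (hammingGraph n k).Adj (f x) (f y)) ∧
      (∀ x y, f x o = f y o) ∧ ∀ x i, ∃ a, f x i = φ i a := by
  obtain ⟨g⟩ := hF
  obtain ⟨e⟩ : Nonempty (Fin d ↪ {i : Fin n // i ≠ o}) :=
    Function.Embedding.nonempty_of_card_le (by simp [Fintype.card_subtype_compl]; omega)
  let e' : Fin d → Fin n := fun j => e j
  have he' : Function.Injective e' := Subtype.val_injective.comp e.injective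
  -- The letter `none` fills every coordinate outside the range of `e'`, in particular `o`, which
  -- makes the image constant there.
  let code : X → Fin n → Option (Fin m) := fun x =>
    Function.extend e' (fun j => some (g x j)) fun _ => none
  have code_e : ∀ x j, code x (e' j) = some (g x j) := fun x j => he'.extend_apply _ _ _
  have code_n : ∀ x i, (¬ ∃ j, e' j = i) → code x i = none := fun x i h =>
    Function.extend_apply' _ _ _ h
  have ne_e : ∀ x y j, φ (e' j) (code x (e' j)) ≠ φ (e' j) (code y (e' j)) ↔ g x j ≠ g y j := by
    intro x y j
    rw [(hφ _).ne_iff, code_e, code_e, Ne, Option.some_inj]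
  have ne_n : ∀ x y i, φ i (code x i) ≠ φ i (code y i) → ∃ j, e' j = i := by
    intro x y i h
    by_contra h'
    exact h (by rw [code_n x i h', code_n y i h'])
  refine ⟨fun x i => φ i (code x i), fun x y h => ?_, fun x y => ?_, fun x y => ?_,
    fun x i => ⟨_, rfl⟩⟩
  · refine g.injective (funext fun j => by_contra fun hj => ?_)
    exact (ne_e x y j).2 hj (congrFun h _)
  · rw [← g.map_adj_iff]
    constructor
    · rintro ⟨j, hj, hj'⟩
      refine ⟨e' j, (ne_e x y j).2 hj, fun i hi => ?_⟩
      obtain ⟨j', rfl⟩ := ne_n x y i hi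
      rw [hj' j' ((ne_e x y j').1 hi)]
    · rintro ⟨i, hi, hi'⟩
      obtain ⟨j, rfl⟩ := ne_n x y i hi
      exact ⟨j, (ne_e x y j).1 hi, fun j' hj' => he' (hi' _ ((ne_e x y j').2 hj'))⟩
  · by_contra h
    obtain ⟨j, hj⟩ := ne_n x y o h
    exact (e j).2 hj

theorem exists_perm_last_two {n : ℕ} (hn : 2 ≤ n) {o κ : Fin n} (h : κ ≠ o) :
    ∃ σ : Equiv.Perm (Fin n), (σ o : ℕ) + 1 = n ∧ (σ κ : ℕ) + 2 = n := by
  let p : Fin n := ⟨n - 1, by omega⟩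
  let q : Fin n := ⟨n - 2, by omega⟩
  have hpq : p ≠ q := by simp [p, q]; omega
  let σ := Equiv.swap o p
  have ho : σ o = p := Equiv.swap_apply_left _ _
  have hκ : p ≠ σ κ := fun h' => h (σ.injective (h'.symm.trans ho.symm))
  refine ⟨σ.trans (Equiv.swap (σ κ) q), ?_, ?_⟩
  · rw [Equiv.trans_apply, ho, Equiv.swap_apply_of_ne_of_ne hκ hpq]
    simp only [p]; omega
  · rw [Equiv.trans_apply, Equiv.swap_apply_left]
    simp only [q]; omega

/-! ### The routing with one special leg -/

/-- If all legs but one start by changing one coordinate of the head, it suffices to specify the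
remaining leg (which goes over `σ` and `μ`). -/
theorem attachSpider_isIndContained_of_special_leg {n k : ℕ} {X : Type*} {F : SimpleGraph X}
    {leaf : Option (Fin n) → X} (hn : 3 ≤ n) (hleaf : Function.Injective leaf)
    {f : X → Fin n → Fin k} (f_inj : Function.Injective f)
    (hF : ∀ x y, F.Adj x y ↔ (hammingGraph n k).Adj (f x) (f y))
    {o o' κ₀ : Fin n} (f_o : ∀ x y, f x o = f y o) (ho : o' ≠ o) (hκ₀ : κ₀ ≠ o)
    {r b σ μ : Fin n → Fin k} {g : Fin k} {a : Option (Fin n) → Fin k}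
    (ha : Function.Injective a) (hra : ∀ l, r o ≠ a l) (hfa : ∀ x l, f x o ≠ a l)
    (hrb : ∀ i, r i ≠ b i) (hfb : ∀ x i, f x i ≠ b i)
    (hrg : r o' ≠ g) (hfg : ∀ x, f x o' ≠ g) (hbg : b o' ≠ g)
    (hfr : ∀ x i, f x i ≠ r i) (hfσ : ∀ x i, f x i ≠ σ i) (hfμ : ∀ x i, f x i ≠ μ i)
    (hσb : ∀ i, i ≠ o → σ i ≠ b i) (hσg : σ o' ≠ g)
    (hμb : ∀ i, i ≠ o → μ i ≠ b i) (hμg : μ o' ≠ g)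
    (hμo : μ o = a none) (hσa : ∀ j, σ o ≠ a (some j)) (hμr : μ κ₀ ≠ r κ₀)
    (hσμ : ∃ e, (e = o ∨ e = κ₀) ∧ ∀ i, σ i ≠ μ i ↔ i = e)
    (hσr : ∀ j, j ≠ o → ∃ i, i ≠ j ∧ σ i ≠ r i)
    {G : SimpleGraph (Fin n → Fin k)}
    (hG : ∀ v w, v ≠ r → v ≠ σ → v ≠ Function.update r o (a (some o)) →
      (G.Adj v w ↔ (hammingGraph n k).Adj v w))
    (hG₁ : ∀ v, (hammingGraph n k).Adj r v → G.Adj r v)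
    (hG₂ : ∀ v w, v ≠ r → w ≠ r → G.Adj v w → (hammingGraph n k).Adj v w)
    (hrσ : G.Adj r σ)
    (hσo : σ ≠ Function.update r o (a (some o)) ∧ ¬ G.Adj σ (Function.update r o (a (some o)))) :
    attachSpider n F leaf ⊴ G := by
  let neck : Fin n → Fin n → Fin k := fun j =>
    Function.update r j (if j = o then a (some o) else b j)
  let κ : Option (Fin n) → Fin n := fun l => l.elim κ₀ fun j => if j = o then o' else j
  let s : Option (Fin n) → Fin n → Fin k := fun l => l.elim σ neck
  -- For `j ≠ o` the neck has `b j` in `j`, and the next step puts the private letter in `o`. The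
  -- neck in direction `o` already has its private letter, so its next step puts `g` in `o'`; `g`
  -- must differ from `b o'`, which the leg in direction `o'` may use.
  let u : Option (Fin n) → Fin n → Fin k := fun l => l.elim μ fun j =>
    Function.update (Function.update r (if j = o then o' else j) (if j = o then g else b j)) o
      (a (some j))
  have hκ : ∀ l, κ l ≠ o := by
    rintro (_ | j)
    · exact hκ₀
    · simp only [κ, Option.elim]; split_ifs <;> assumption
  have hne : ∀ j, r j ≠ if j = o then a (some o) else b j := by
    intro j
    split_ifs with h
    · subst h; exact hra _
    · exact hrb _
  have neck_adj : ∀ j, (hammingGraph n k).Adj r (neck j) := fun j => hammingGraph_adj_update (hne j)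
  have uo : ∀ l, u l o = a l := by
    rintro (_ | j)
    · exact hμo
    · simp [u]
  choose pos hpos using fun l => exists_perm_last_two (by omega : 2 ≤ n) (hκ l)
  let R : Routing n k X (Option (Fin n)) :=
    { f, leaf, o, r, s, u, κ, pos
      three_le := hn
      leaf_injective := hleaf
      f_o := f_o
      f_injective := f_inj
      f_ne_r := hfr
      f_ne_s := by
        rintro x (_ | j) i
        · exact hfσ x i
        · simp only [s, neck, Option.elim, Function.update_apply]
          split_ifs with h1 h2
          · rw [h1, h2]; exact hfa _ _
          · rw [h1]; exact hfb _ _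
          · exact hfr _ _
      f_ne_u := by
        rintro x (_ | j) i
        · exact hfμ x i
        · simp only [u, Option.elim, Function.update_apply]
          split_ifs with h1 h2 h3 h4
          · rw [h1]; exact hfa _ _
          · rw [h3]; exact hfg _
          · exact hfr _ _
          · rw [h4]; exact hfb _ _
          · exact hfr _ _
      r_o := fun l => by rw [uo]; exact hra l
      u_o := fun l l' h => by rw [uo, uo]; exact ha.ne h
      s_o := by
        rintro (_ | j) (_ | j') h
        · exact absurd rfl h
        · rw [uo]; exact hσa _
        all_goals
          rw [uo]
          simp only [s, neck, Option.elim, Function.update_apply]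
          split_ifs with h1 h2
          · rw [h1]; exact ha.ne (h1 ▸ h2 ▸ h)
          · exact absurd h1.symm h2
          · exact hra _
      κ_ne := hκ
      r_κ := by
        rintro (_ | j)
        · exact hμr.symm
        · by_cases h : j = o
          · simpa [κ, u, h, ho] using hrg
          · simpa [κ, u, h] using hrb j
      u_κ := by
        rintro (_ | j) (_ | j') h
        · exact absurd rfl h
        · simp only [κ, u, Option.elim, Function.update_apply, if_neg hκ₀]
          split_ifs with h1 h2 h3
          · rw [h2]; exact hμg.symm
          · exact hμr.symm
          · rw [← h3]; exact (hμb _ hκ₀).symm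
          · exact hμr.symm
        · by_cases h1 : j = o
          · simpa [κ, u, h1, ho] using hμg
          · simpa [κ, u, h1] using hμb j h1
        · have hj : j ≠ j' := fun h' => h (h' ▸ rfl)
          by_cases h1 : j = o
          · subst h1
            simp only [κ, u, Option.elim, Function.update_apply, if_pos, if_neg ho, if_neg hj.symm]
            split_ifs with h2
            · rw [← h2]; exact hbg
            · exact hrg
          · simp only [κ, u, Option.elim, Function.update_apply, if_neg h1, if_pos]
            split_ifs with h2 h3
            · rw [h3]; exact hbg.symm
            · exact hrb _
            · exact hrb _
      s_κ := by
        rintro (_ | j) (_ | j') h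
        · exact absurd rfl h
        · simp only [κ, u, s, neck, Option.elim, Function.update_apply]
          split_ifs with h1 h2
          · exact absurd (h1.trans h2) hκ₀
          · rw [← h1]; exact (hμb _ hκ₀).symm
          · exact hμr.symm
        · by_cases h1 : j = o
          · simpa [κ, u, s, h1, ho] using hσg
          · simpa [κ, u, s, h1] using hσb j h1
        · have hj : j ≠ j' := fun h' => h (h' ▸ rfl)
          by_cases h1 : j = o
          · subst h1
            simp only [κ, u, s, neck, Option.elim, Function.update_apply, if_pos, if_neg ho,
              if_neg hj.symm]
            split_ifs with h2
            · rw [← h2]; exact hbg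
            · exact hrg
          · simp only [κ, u, s, neck, Option.elim, Function.update_apply, if_neg h1, if_pos,
              if_neg hj]
            exact hrb _
      s_u := by
        rintro (_ | j)
        · exact hσμ
        · by_cases h1 : j = o
          · refine ⟨o', by simp [κ, h1], fun i => ?_⟩
            by_cases h2 : i = o
            · subst h2; simp [s, u, neck, h1, ho.symm]
            · by_cases h3 : i = o'
              · subst h3; simpa [s, u, neck, h1, h2] using hrg
              · simp [s, u, neck, h1, h2, h3]
          · refine ⟨o, by simp, fun i => ?_⟩
            by_cases h2 : i = o
            · subst h2; simpa [s, u, neck, h1, Ne.symm h1] using hra _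
            · by_cases h3 : i = j
              · subst h3; simp [s, u, neck, h2]
              · simp [s, u, neck, h1, h2, h3]
      pos_o := fun l => (hpos l).1
      pos_κ := fun l => (hpos l).2 }
  have neck_ne : ∀ j, neck j ≠ r := fun j => (neck_adj j).ne'
  have neck_o : neck o = Function.update r o (a (some o)) := by simp [neck]
  have hσ_ne : σ ≠ r := hrσ.ne'
  have hnn : ∀ j j', j ≠ j' → neck j ≠ neck j' ∧ ¬ G.Adj (neck j) (neck j') := by
    intro j j' hj
    have : Far (neck j) (neck j') := by
      refine ⟨j, j', hj, ?_, ?_⟩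
      · simp only [neck, Function.update_self, Function.update_of_ne hj]
        exact (hne j).symm
      · simp only [neck, Function.update_self, Function.update_of_ne hj.symm]
        exact hne j'
    exact ⟨this.ne, fun h => this.not_adj (hG₂ _ _ (neck_ne _) (neck_ne _) h)⟩
  have hσn : ∀ j, σ ≠ neck j ∧ ¬ G.Adj σ (neck j) := by
    intro j
    by_cases h : j = o
    · subst h; rw [neck_o]; exact hσo
    · have : Far σ (neck j) := by
        obtain ⟨i, hi, hi'⟩ := hσr j h
        refine ⟨j, i, hi.symm, ?_, ?_⟩
        · simpa [neck, h] using hσb j h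
        · simpa [neck, hi] using hi'
      exact ⟨this.ne, fun h => this.not_adj (hG₂ _ _ hσ_ne (neck_ne _) h)⟩
  refine R.isIndContained hF (fun v w h1 h2 => hG v w h1 (h2 none) ?_) ?_ ?_
  · rw [← neck_o]; exact h2 (some o)
  · rintro (_ | j)
    · exact hrσ
    · exact hG₁ _ (neck_adj j)
  · rintro (_ | j) (_ | j') h
    · exact absurd rfl h
    · exact hσn j'
    · exact ⟨(hσn j).1.symm, fun h => (hσn j).2 h.symm⟩
    · exact hnn _ _ fun h' => h (h' ▸ rfl)

/-! ### Fresh letters and the two kinds of edge change -/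

/-- Letters that avoid two given tuples: `inl` for the tuples of the graph, `inr (inl _)` for the
first letters of the legs, and four more. -/
theorem exists_letters {m n k : ℕ} (hk : m + n + 8 ≤ k) (p q : Fin n → Fin k) :
    ∃ φ : Fin n → Option (Fin m) ⊕ Option (Fin n) ⊕ Fin 4 → Fin k,
      (∀ i, Function.Injective (φ i)) ∧ (∀ i c, φ i c ≠ p i) ∧ ∀ i c, φ i c ≠ q i := by
  have : ∀ i, Nonempty (Option (Fin m) ⊕ Option (Fin n) ⊕ Fin 4 ↪
      {v : Fin k // v ∉ ({p i, q i} : Finset (Fin k))}) := by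
    intro i
    refine Function.Embedding.nonempty_of_card_le ?_
    have h2 : ({p i, q i} : Finset (Fin k)).card ≤ 2 := Finset.card_le_two
    rw [Fintype.card_subtype_compl, Fintype.card_coe]
    -- There are (m + 1) + (n + 1) + 4 letters to choose, and at most 2 are forbidden; hence the
    -- bound m + n + 8.
    simp only [Fintype.card_sum, Fintype.card_option, Fintype.card_fin]
    omega
  let e := fun i => (this i).some
  refine ⟨fun i c => e i c, fun i => Subtype.val_injective.comp (e i).injective, ?_, ?_⟩ <;>
  · intro i c h
    exact (e i c).2 (by simp [h])

section Saturation

variable {X : Type*} {F : SimpleGraph X} {d m n k : ℕ} {leaf : Option (Fin n) → X}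

/-- The head `r` is a third point on the line through x and y. Both ends of the deleted edge become
necks: x is the regular neck in direction `o`, y the special one. -/
theorem attachSpider_isIndContained_deleteEdges (hn : 3 ≤ n) (hF : F ⊴ hammingGraph d m)
    (hd : d < n) (hleaf : Function.Injective leaf) (hk : m + n + 8 ≤ k) {x y : Fin n → Fin k}
    (hxy : (hammingGraph n k).Adj x y) :
    attachSpider n F leaf ⊴ (hammingGraph n k).deleteEdges {s(x, y)} := by
  obtain ⟨o, hxo, hxy'⟩ := id hxy
  have hoff : ∀ i, i ≠ o → x i = y i := fun i hi => by_contra fun h => hi (hxy' i h)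
  obtain ⟨φ, φ_inj, φ_x, φ_y⟩ := exists_letters hk x y
  obtain ⟨f, f_inj, f_adj, f_o, f_φ⟩ := exists_hyperplane_embedding hF hd o
    (fun i c => φ i (Sum.inl c)) fun i => (φ_inj i).comp Sum.inl_injective
  have : Nontrivial (Fin n) := Fin.nontrivial_iff_two_le.2 (by omega)
  obtain ⟨o', ho'⟩ := exists_ne o
  have φ_ne : ∀ i {c c'}, c ≠ c' → φ i c ≠ φ i c' := fun i _ _ h => (φ_inj i).ne h
  let L (t : Fin 4) : Option (Fin m) ⊕ Option (Fin n) ⊕ Fin 4 := Sum.inr (Sum.inr t)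
  have f_L : ∀ z i t, f z i ≠ φ i (L t) := fun z i t => by
    obtain ⟨c, hc⟩ := f_φ z i
    rw [hc]; exact φ_ne i (by simp [L])
  have f_x : ∀ z i, f z i ≠ x i := fun z i => by
    obtain ⟨c, hc⟩ := f_φ z i
    rw [hc]; exact φ_x i _
  have f_y : ∀ z i, f z i ≠ y i := fun z i => by
    obtain ⟨c, hc⟩ := f_φ z i
    rw [hc]; exact φ_y i _
  have L_ne : ∀ i {t t'}, t ≠ t' → φ i (L t) ≠ φ i (L t') := fun i _ _ h =>
    φ_ne i (by simpa [L] using h)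
  let r := Function.update x o (φ o (L 0))
  -- Two of the private letters are forced: the necks y and x already show `y o` and `x o`.
  let a : Option (Fin n) → Fin k := fun l =>
    l.elim (y o) fun j => if j = o then x o else φ o (Sum.inr (Sum.inl (some j)))
  have r_o : r o = φ o (L 0) := Function.update_self _ _ _
  have r_off : ∀ i, i ≠ o → r i = x i := fun i hi => Function.update_of_ne hi _ _
  have hx : Function.update r o (a (some o)) = x := by simp [r, a]
  have x_r : x ≠ r := fun h => φ_x o (L 0) (by rw [← r_o, ← h])
  have y_r : y ≠ r := fun h => φ_y o (L 0) (by rw [← r_o, ← h])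
  have hr : ∀ i, r i = x i ∨ r i = φ i (L 0) := fun i => by
    by_cases hi : i = o
    · subst hi; exact Or.inr r_o
    · exact Or.inl (r_off i hi)
  have r_L : ∀ i t, t ≠ 0 → r i ≠ φ i (L t) := fun i t ht => by
    rcases hr i with h | h <;> rw [h]
    · exact (φ_x _ _).symm
    · exact L_ne i ht.symm
  refine attachSpider_isIndContained_of_special_leg (o := o) (o' := o') (κ₀ := o') (r := r)
    (b := fun i => φ i (L 1)) (g := φ o' (L 2)) (σ := y)
    (μ := Function.update y o' (φ o' (L 3))) (a := a)
    hn hleaf f_inj f_adj f_o ho' ho' ?_ ?_ ?_ (fun i => r_L i 1 (by decide)) (fun z i => f_L z i 1)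
    (r_L o' 2 (by decide)) (fun z => f_L z o' 2) (L_ne o' (by decide)) ?_ f_y ?_
    (fun i _ => (φ_y _ _).symm) (φ_y _ _).symm ?_ ?_ ?_ ?_ ?_ ?_ ?_ ?_ ?_ ?_ ?_ ?_
  · have hj : ∀ j j', j ≠ j' → φ o (Sum.inr (Sum.inl (some j))) ≠
        φ o (Sum.inr (Sum.inl (some j'))) := fun j j' h => φ_ne o (by simpa using h)
    rintro (_ | j) (_ | j') h
    · rfl
    · simp only [a, Option.elim] at h
      split_ifs at h
      · exact absurd h.symm hxo
      · exact absurd h.symm (φ_y _ _)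
    · simp only [a, Option.elim] at h
      split_ifs at h
      · exact absurd h hxo
      · exact absurd h (φ_y _ _)
    · simp only [a, Option.elim] at h
      split_ifs at h with h1 h2 h2
      · rw [h1, h2]
      · exact absurd h.symm (φ_x _ _)
      · exact absurd h (φ_x _ _)
      · by_contra hne
        exact hj j j' (fun h => hne (h ▸ rfl)) h
  · rintro (_ | j)
    · rw [r_o]; exact φ_y _ _
    · rw [r_o]; simp only [a, Option.elim]
      split_ifs
      · exact φ_x _ _
      · exact φ_ne _ (by simp [L])
  · rintro z (_ | j)
    · exact f_y z o
    · simp only [a, Option.elim]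
      split_ifs
      · exact f_x z o
      · obtain ⟨c, hc⟩ := f_φ z o
        rw [hc]; exact φ_ne o (by simp)
  · intro z i
    rcases hr i with h | h <;> rw [h]
    · exact f_x z i
    · exact f_L z i 0
  · intro z i
    by_cases hi : i = o'
    · subst hi; simpa using f_L z i 3
    · simpa [hi] using f_y z i
  · intro i _
    by_cases hi : i = o'
    · subst hi; simpa using L_ne i (by decide : (3 : Fin 4) ≠ 1)
    · simpa [hi] using (φ_y i _).symm
  · simpa using L_ne o' (by decide : (3 : Fin 4) ≠ 2)
  · simp [a, ho'.symm]
  · intro j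
    simp only [a, Option.elim]
    split_ifs
    · exact hxo.symm
    · exact (φ_y _ _).symm
  · simpa using (r_L o' 3 (by decide)).symm
  -- As y has its private letter already, the special leg continues by changing `o'`, where y still
  -- agrees with the head.
  · refine ⟨o', Or.inr rfl, fun i => ?_⟩
    by_cases hi : i = o'
    · subst hi; simpa using (φ_y i _).symm
    · simp [hi]
  · exact fun j hj => ⟨o, hj.symm, by rw [r_o]; exact (φ_y _ _).symm⟩
  · rw [hx]
    intro v w _ h2 h3
    simp [SimpleGraph.deleteEdges_adj, h2, h3]
  · intro v h
    simp [SimpleGraph.deleteEdges_adj, h, x_r.symm, y_r.symm]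
  · intro v w _ _ h
    exact (SimpleGraph.deleteEdges_adj.1 h).1
  · have : (hammingGraph n k).Adj r y := by
      refine hammingGraph_adj_of_iff (e := o) fun i => ?_
      by_cases hi : i = o
      · subst hi; simpa [r_o] using φ_y _ _
      · simp [r_off i hi, hoff i hi, hi]
    simp [SimpleGraph.deleteEdges_adj, this, x_r.symm, y_r.symm]
  · rw [hx]
    exact ⟨hxy.ne', by simp [SimpleGraph.deleteEdges_adj]⟩

/-- With the head at x, the new edge reaches the additional neck y. Since x and y differ in two
coordinates, y is far from every regular neck, whose changed letter is fresh. -/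
theorem attachSpider_isIndContained_sup_edge (hn : 3 ≤ n) (hF : F ⊴ hammingGraph d m)
    (hd : d < n) (hleaf : Function.Injective leaf) (hk : m + n + 8 ≤ k) {x y : Fin n → Fin k}
    (hxy : Far x y) : attachSpider n F leaf ⊴ hammingGraph n k ⊔ SimpleGraph.edge x y := by
  have hadd : ∀ v w, (hammingGraph n k ⊔ SimpleGraph.edge x y).Adj v w ↔
      (hammingGraph n k).Adj v w ∨ (v = x ∧ w = y ∨ v = y ∧ w = x) := by
    intro v w
    rw [SimpleGraph.sup_adj, SimpleGraph.edge_adj]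
    have := hxy.ne
    constructor
    · rintro (h | ⟨h, -⟩)
      · exact Or.inl h
      · exact Or.inr (by tauto)
    · rintro (h | ⟨rfl, rfl⟩ | ⟨rfl, rfl⟩)
      · exact Or.inl h
      · exact Or.inr ⟨by tauto, this⟩
      · exact Or.inr ⟨by tauto, this.symm⟩
  have hdiff : ∀ j, ∃ i, i ≠ j ∧ x i ≠ y i := by
    intro j
    obtain ⟨i, i', hi, h1, h2⟩ := hxy
    by_cases h : i = j
    · exact ⟨i', fun h' => hi (h.trans h'.symm), h2⟩
    · exact ⟨i, h, h1⟩
  obtain ⟨φ, φ_inj, φ_x, φ_y⟩ := exists_letters hk x y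
  let o : Fin n := ⟨0, by omega⟩
  -- Any `o` will do: x and y differ in some other coordinate `κ₀`, which separates the special leg
  -- from the head while `o` receives the private letter.
  obtain ⟨κ₀, hκ₀, hκxy⟩ := hdiff o
  obtain ⟨f, f_inj, f_adj, f_o, f_φ⟩ := exists_hyperplane_embedding hF hd o
    (fun i c => φ i (Sum.inl c)) fun i => (φ_inj i).comp Sum.inl_injective
  have φ_ne : ∀ i {c c'}, c ≠ c' → φ i c ≠ φ i c' := fun i _ _ h => (φ_inj i).ne h
  have f_r : ∀ z i t, f z i ≠ φ i (Sum.inr t) := fun z i t => by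
    obtain ⟨c, hc⟩ := f_φ z i
    rw [hc]; exact φ_ne i (by simp)
  have f_x : ∀ z i, f z i ≠ x i := fun z i => by
    obtain ⟨c, hc⟩ := f_φ z i
    rw [hc]; exact φ_x i _
  have f_y : ∀ z i, f z i ≠ y i := fun z i => by
    obtain ⟨c, hc⟩ := f_φ z i
    rw [hc]; exact φ_y i _
  let a : Option (Fin n) → Fin k := fun l => φ o (Sum.inr (Sum.inl l))
  refine attachSpider_isIndContained_of_special_leg (o := o) (o' := κ₀) (κ₀ := κ₀) (r := x)
    (b := fun i => φ i (Sum.inr (Sum.inr 0))) (g := φ κ₀ (Sum.inr (Sum.inr 1))) (σ := y)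
    (μ := Function.update y o (a none)) (a := a)
    hn hleaf f_inj f_adj f_o hκ₀ hκ₀
    ((φ_inj o).comp (Sum.inr_injective.comp Sum.inl_injective)) (fun l => (φ_x _ _).symm)
    (fun z l => f_r z o _) (fun i => (φ_x _ _).symm) (fun z i => f_r z i _) (φ_x _ _).symm
    (fun z => f_r z κ₀ _) (φ_ne _ (by simp)) f_x f_y ?_ (fun i _ => (φ_y _ _).symm) (φ_y _ _).symm
    ?_ ?_ ?_ (fun j => (φ_y _ _).symm) ?_ ?_ ?_ ?_ ?_ ?_ ?_ ?_
  · intro z i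
    by_cases hi : i = o
    · subst hi; simpa using f_r z o _
    · simpa [hi] using f_y z i
  · intro i hi
    simpa [hi] using (φ_y i _).symm
  · simpa [hκ₀] using (φ_y _ _).symm
  · simp
  · simpa [hκ₀] using hκxy.symm
  · refine ⟨o, Or.inl rfl, fun i => ?_⟩
    by_cases hi : i = o
    · rw [hi]; simpa using (φ_y o _).symm
    · simp [hi]
  · intro j _
    obtain ⟨i, hi, h⟩ := hdiff j
    exact ⟨i, hi, h.symm⟩
  · intro v w h1 h2 _
    simp [hadd, h1, h2]
  · exact fun v h => (hadd _ _).2 (Or.inl h)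
  · intro v w h1 h2 h
    simpa [h1, h2] using (hadd _ _).1 h
  · exact (hadd _ _).2 (Or.inr (Or.inl ⟨rfl, rfl⟩))
  · have hfar : Far y (Function.update x o (a (some o))) := by
      refine ⟨o, κ₀, hκ₀.symm, by simpa using (φ_y _ _).symm, ?_⟩
      simpa [hκ₀] using hκxy.symm
    have hne : Function.update x o (a (some o)) ≠ x := fun h => by
      have := congrFun h o
      rw [Function.update_self] at this
      exact φ_x _ _ this
    refine ⟨hfar.ne, fun h => ?_⟩
    rcases (hadd _ _).1 h with h | ⟨h, -⟩ | ⟨-, h⟩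
    · exact hfar.not_adj h
    · exact hxy.ne h.symm
    · exact hne h

end Saturation

end InducedSaturation

theorem theoremB {V : Type*} (n : ℕ) (hn : 3 ≤ n) (H : SimpleGraph V)
    (hH : InducedSaturation.ClassF n H) :
    ∃ k : ℕ, 2 ≤ k ∧ InducedSaturation.IsInducedSaturated
      (InducedSaturation.hammingGraph n k) H := by
  obtain ⟨F, T, hFT, hdim, hT, hleaves⟩ := hH
  obtain ⟨d, hd, m, hF⟩ := InducedSaturation.exists_isIndContained_of_hammingDim_le hdim
  obtain ⟨leaf, hleaf, ⟨e⟩⟩ := InducedSaturation.exists_iso_attachSpider (by omega) (by omega)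
    -- Of the n + 1 legs, `some j` is the one starting in direction `j`, and `none` is the special
    -- one.
    hFT hT hleaves (Fintype.equivFinOfCardEq (by simp) : Option (Fin n) ≃ Fin (n + 1))
  have hH : H ⊴ InducedSaturation.attachSpider n F.coe leaf := ⟨e.toEmbedding⟩
  refine ⟨m + n + 8, by omega, fun h => ?_, fun x y hxy => ?_, fun x y hxy => ?_⟩
  · exact InducedSaturation.not_attachSpider_isIndContained (by simp) F.coe leaf
      (SimpleGraph.IsIndContained.trans ⟨e.symm.toEmbedding⟩ h)
  · exact hH.trans
      (InducedSaturation.attachSpider_isIndContained_deleteEdges hn hF (by omega) hleaf le_rfl hxy)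
  · rw [SimpleGraph.compl_adj] at hxy
    exact hH.trans (InducedSaturation.attachSpider_isIndContained_sup_edge hn hF (by omega) hleaf le_rfl
      ((InducedSaturation.hammingGraph_adj_or_far hxy.1).resolve_left hxy.2))
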